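/- Let $\Omega\subset\mathbb C^n$ be a bounded domain (non-empty, open, connected) that is Reinhardt, i.e. $(e^{i\theta_1}z_1,\dots,e^{i\theta_n}z_n)\in\Omega$ whenever $z\in\Omega$ and $\theta\in\mathbb R^n$. Let $A^2(\Omega)$ be the Bergman space of holomorphic functions in $L^2(\Omega)$ with respect to Lebesgue measure, let $P:L^2(\Omega)\to A^2(\Omega)$ be the orthogonal projection, and for $\phi\in L^\infty(\Omega)$ let $T_\phi:A^2(\Omega)\to A^2(\Omega)$, $T_\phi f=P(\phi f)$, be the Toeplitz operator with symbol $\phi$. Let $\phi_1,\dots,\phi_m\in L^\infty(\Omega)$ be quasi-homogeneous: for each $j$ there are a function $f_j:[0,\infty)^n\to\mathbb C$ and a multi-index $\mathbf k_j\in\mathbb Z^n$ such that $$\phi_j(r_1e^{i\theta_1},\dots,r_ne^{i\theta_n})=f_j(r_1,\dots,r_n)\,e^{i\mathbf k_j\cdot\theta}$$ for all $r\in[0,\infty)^n$ and $\theta\in\mathbb R^n$ with $(r_1e^{i\theta_1},\dots,r_ne^{i\theta_n})\in\Omega$. If $T_{\phi_m}\cdots T_{\phi_1}=0$ on $A^2(\Omega)$,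 then $\phi_j=0$ almost everywhere on $\Omega$ for some $j\in\{1,\dots,m\}$. -/

import Mathlib

open MeasureTheory TopologicalSpace Metric Set Filter Topology
open scoped ENNReal

namespace Bergman

/-! ### Auxiliary facts: the Bergman space is closed in `L²` -/

/-- Simultaneous rotation of all coordinates preserves Lebesgue measure on `ℂⁿ`. -/
theorem measurePreserving_rotate {n : ℕ} (θ : ℝ) :
    MeasurePreserving (fun w : Fin n → ℂ => Complex.exp (θ * Complex.I) • w) := by
  have h := volume_preserving_pi (fun _ : Fin n =>
    (rotation (Circle.exp θ)).measurePreserving)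
  have e : (fun w : Fin n → ℂ => Complex.exp (θ * Complex.I) • w)
      = fun (a : Fin n → ℂ) i => rotation (Circle.exp θ) (a i) := by
    funext w i
    simp [rotation_apply, Circle.coe_exp]
  rw [e]
  exact h

/-- The one-variable mean value inequality on a complex line through `z`. -/
theorem enorm_le_lintegral_circle {n : ℕ} {g : (Fin n → ℂ) → ℂ} {Ω : Set (Fin n → ℂ)}
    (hg : DifferentiableOn ℂ g Ω) {z w : Fin n → ℂ} {r : ℝ}
    (hr : ball z r ⊆ Ω) (hw : w ∈ ball (0 : Fin n → ℂ) r) :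
    ENNReal.ofReal (2 * Real.pi) * ‖g z‖ₑ ≤
      ∫⁻ θ in Ioc 0 (2 * Real.pi), ‖g (z + Complex.exp (θ * Complex.I) • w)‖ₑ := by
  have hmem : ∀ t : ℂ, ‖t‖ ≤ 1 → z + t • w ∈ ball z r := by
    intro t ht
    rw [mem_ball_zero_iff] at hw
    rw [mem_ball, dist_eq_norm, add_sub_cancel_left, norm_smul]
    nlinarith [norm_nonneg w, norm_nonneg t]
  have hd : DifferentiableOn ℂ (fun t : ℂ => g (z + t • w)) (closedBall 0 1) := by
    refine (hg.mono hr).comp (t := ball z r) (by fun_prop) ?_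
    intro t ht
    exact hmem t (by simpa using ht)
  have hdc : DiffContOnCl ℂ (fun t : ℂ => g (z + t • w)) (ball 0 |1|) := by
    refine DifferentiableOn.diffContOnCl ?_
    rw [abs_one, closure_ball _ one_ne_zero]
    exact hd
  have hm := hdc.circleAverage
  rw [Real.circleAverage_def] at hm
  have hm2 : ((2 * Real.pi : ℝ) : ℂ) * g z =
      ∫ θ in Ioc 0 (2 * Real.pi), g (z + Complex.exp (θ * Complex.I) • w) := by
    rw [← intervalIntegral.integral_of_le (by positivity)]
    simp only [zero_smul, add_zero, circleMap, zero_add, Complex.ofReal_one, one_mul,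
      Complex.real_smul] at hm
    rw [← hm, ← mul_assoc, ← Complex.ofReal_mul, mul_inv_cancel₀ (by positivity)]
    simp
  calc ENNReal.ofReal (2 * Real.pi) * ‖g z‖ₑ = ‖((2 * Real.pi : ℝ) : ℂ) * g z‖ₑ := by
        rw [enorm_mul]
        congr 1
        rw [← ofReal_norm, Complex.norm_real, Real.norm_of_nonneg (by positivity)]
    _ ≤ _ := by
        rw [hm2]
        exact enorm_integral_le_lintegral_enorm _

/-- Sub-mean value inequality over a polydisc. -/
theorem enorm_mul_volume_le {n : ℕ} {g : (Fin n → ℂ) → ℂ} {Ω : Set (Fin n → ℂ)}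
    (hΩ : IsOpen Ω) (hg : DifferentiableOn ℂ g Ω) {z : Fin n → ℂ} {r : ℝ}
    (hr : ball z r ⊆ Ω) :
    ‖g z‖ₑ * volume (ball (0 : Fin n → ℂ) r) ≤ ∫⁻ w in ball z r, ‖g w‖ₑ := by
  classical
  set G : (Fin n → ℂ) → ℂ := Ω.indicator g with hG
  have hGm : Measurable G := by
    have := hg.continuousOn.measurable_piecewise (g := fun _ => (0 : ℂ)) continuousOn_const
      hΩ.measurableSet
    simpa [hG, Set.piecewise_eq_indicator] using! this
  set c := ENNReal.ofReal (2 * Real.pi) with hc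
  have hc0 : c ≠ 0 := by
    rw [hc]
    simp [Real.pi_pos]
  have hct : c ≠ ∞ := ENNReal.ofReal_ne_top
  have hgG : ∀ y ∈ ball z r, G y = g y := fun y hy => indicator_of_mem (hr hy) _
  have hrot : ∀ (θ : ℝ) (w : Fin n → ℂ),
      Complex.exp (θ * Complex.I) • w ∈ ball (0 : Fin n → ℂ) r ↔ w ∈ ball (0 : Fin n → ℂ) r := by
    intro θ w
    rw [mem_ball_zero_iff, mem_ball_zero_iff, norm_smul, Complex.norm_exp_ofReal_mul_I, one_mul]
  have htrans : ∀ w ∈ ball (0 : Fin n → ℂ) r, z + w ∈ ball z r := by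
    intro w hw
    simpa [mem_ball, dist_eq_norm] using hw
  have hmeas : Measurable (fun p : (Fin n → ℂ) × ℝ =>
      ‖G (z + Complex.exp (p.2 * Complex.I) • p.1)‖ₑ) := by
    refine (hGm.comp ?_).enorm
    exact Continuous.measurable (by fun_prop)
  have key : c * (‖g z‖ₑ * volume (ball (0 : Fin n → ℂ) r)) ≤
      c * ∫⁻ w in ball z r, ‖g w‖ₑ := by
    calc c * (‖g z‖ₑ * volume (ball (0 : Fin n → ℂ) r))
        = ∫⁻ _ in ball (0 : Fin n → ℂ) r, c * ‖g z‖ₑ := by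
          rw [setLIntegral_const, mul_assoc]
      _ ≤ ∫⁻ w in ball (0 : Fin n → ℂ) r, ∫⁻ θ in Ioc 0 (2 * Real.pi),
            ‖G (z + Complex.exp (θ * Complex.I) • w)‖ₑ := by
          refine setLIntegral_mono' measurableSet_ball fun w hw => ?_
          refine (enorm_le_lintegral_circle hg hr hw).trans_eq ?_
          refine lintegral_congr fun θ => ?_
          rw [hgG _ (htrans _ ((hrot θ w).2 hw))]
      _ = ∫⁻ θ in Ioc 0 (2 * Real.pi), ∫⁻ w in ball (0 : Fin n → ℂ) r,
            ‖G (z + Complex.exp (θ * Complex.I) • w)‖ₑ :=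
          lintegral_lintegral_swap hmeas.aemeasurable
      _ = ∫⁻ _ in Ioc 0 (2 * Real.pi), ∫⁻ w in ball z r, ‖g w‖ₑ := by
          refine lintegral_congr fun θ => ?_
          have h1 := (measurePreserving_rotate (n := n) θ).setLIntegral_comp_preimage
            (s := ball (0 : Fin n → ℂ) r) (f := fun w => ‖G (z + w)‖ₑ) measurableSet_ball
            ((hGm.comp (measurable_const_add z)).enorm)
          have h2 : (fun w : Fin n → ℂ => Complex.exp (θ * Complex.I) • w) ⁻¹'
              ball (0 : Fin n → ℂ) r = ball (0 : Fin n → ℂ) r := by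
            ext w
            exact hrot θ w
          rw [h2] at h1
          rw [h1]
          have h3 := (measurePreserving_add_left (volume : Measure (Fin n → ℂ))
            z).setLIntegral_comp_preimage (s := ball z r) (f := fun w => ‖G w‖ₑ)
            measurableSet_ball hGm.enorm
          have h4 : (fun w : Fin n → ℂ => z + w) ⁻¹' ball z r = ball (0 : Fin n → ℂ) r := by
            ext w
            simp [mem_ball, dist_eq_norm]
          rw [h4] at h3
          rw [h3]
          exact setLIntegral_congr_fun measurableSet_ball fun y hy => by simp only [hgG y hy]
      _ = c * ∫⁻ w in ball z r, ‖g w‖ₑ := by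
          rw [setLIntegral_const, mul_comm, Real.volume_Ioc, sub_zero]
  exact (ENNReal.mul_le_mul_iff_right hc0 hct).1 key

/-- Point evaluations are bounded on `A²`, uniformly over points at a fixed distance from the
boundary. -/
theorem exists_bound (n : ℕ) {r : ℝ} (hr0 : 0 < r) :
    ∃ C : ℝ, 0 < C ∧ ∀ (Ω : Set (Fin n → ℂ)) (_ : IsOpen Ω) (g : (Fin n → ℂ) → ℂ)
      (_ : DifferentiableOn ℂ g Ω) (F : Lp ℂ 2 (volume.restrict Ω))
      (_ : F =ᵐ[volume.restrict Ω] g) (z : Fin n → ℂ) (_ : ball z r ⊆ Ω),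
      ‖g z‖ ≤ C * ‖F‖ := by
  set V := volume (ball (0 : Fin n → ℂ) r) with hV
  have hV0 : V ≠ 0 := (measure_ball_pos volume 0 hr0).ne'
  have hVt : V ≠ ∞ := measure_ball_lt_top.ne
  set D : ℝ≥0∞ := V ^ ((1 : ℝ) / 1 - 1 / 2) / V with hD
  have hDt : D ≠ ∞ := ENNReal.div_ne_top
    (ENNReal.rpow_ne_top_of_nonneg (by norm_num) hVt) hV0
  have hD0 : D ≠ 0 := ENNReal.div_ne_zero.2 ⟨(ENNReal.rpow_pos (pos_iff_ne_zero.2 hV0) hVt).ne', hVt⟩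
  refine ⟨D.toReal, ENNReal.toReal_pos hD0 hDt, ?_⟩
  intro Ω hΩ g hg F hF z hz
  have hle : (volume.restrict (ball z r)) ≤ (volume.restrict Ω) := Measure.restrict_mono hz le_rfl
  have h1 := enorm_mul_volume_le hΩ hg hz
  have hgm : AEStronglyMeasurable g (volume.restrict Ω) :=
    (Lp.aestronglyMeasurable F).congr hF
  have h2 := eLpNorm_le_eLpNorm_mul_rpow_measure_univ (μ := volume.restrict (ball z r))
    (p := 1) (q := 2) (by norm_num) (hgm.mono_measure hle)
  have hvol : volume (ball z r) = V := by
    rw [hV, Measure.addHaar_ball_center]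
  rw [eLpNorm_one_eq_lintegral_enorm, Measure.restrict_apply_univ, hvol] at h2
  have h3 : eLpNorm g 2 (volume.restrict (ball z r)) ≤ ‖F‖ₑ := by
    rw [Lp.enorm_def, eLpNorm_congr_ae hF]
    exact eLpNorm_mono_measure _ hle
  have h4 : ‖g z‖ₑ ≤ D * ‖F‖ₑ := by
    have h5 : ‖g z‖ₑ * V ≤ ‖F‖ₑ * V ^ ((1 : ℝ) / 1 - 1 / 2) := by
      refine h1.trans (h2.trans ?_)
      simp only [ENNReal.toReal_one, ENNReal.toReal_ofNat]
      gcongr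
    rw [hD, mul_comm, ← mul_div_assoc]
    exact (ENNReal.le_div_iff_mul_le (Or.inl hV0) (Or.inl hVt)).2 h5
  have h5 := ENNReal.toReal_mono (ENNReal.mul_ne_top hDt enorm_ne_top) h4
  simpa [ENNReal.toReal_mul] using h5

/-- A locally uniformly Cauchy and pointwise convergent sequence of holomorphic functions of
several variables has a holomorphic limit. -/
theorem differentiableOn_limit {n : ℕ} {Ω : Set (Fin n → ℂ)} (hΩ : IsOpen Ω)
    {f : ℕ → (Fin n → ℂ) → ℂ} (hf : ∀ k, DifferentiableOn ℂ (f k) Ω)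
    (hc : ∀ z ∈ Ω, ∃ r > 0, ball z r ⊆ Ω ∧ ∀ ε > 0, ∃ N, ∀ k ≥ N, ∀ l ≥ N,
      ∀ w ∈ ball z r, ‖f k w - f l w‖ ≤ ε) :
    ∃ g : (Fin n → ℂ) → ℂ, DifferentiableOn ℂ g Ω ∧
      ∀ z ∈ Ω, Tendsto (fun k => f k z) atTop (𝓝 (g z)) := by
  have hpt : ∀ z ∈ Ω, ∃ y, Tendsto (fun k => f k z) atTop (𝓝 y) := by
    intro z hz
    obtain ⟨r, hr, -, h⟩ := hc z hz
    refine cauchySeq_tendsto_of_complete (Metric.cauchySeq_iff.2 fun ε hε => ?_)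
    obtain ⟨N, hN⟩ := h (ε / 2) (half_pos hε)
    refine ⟨N, fun k hk l hl => ?_⟩
    rw [dist_eq_norm]
    exact (hN k hk l hl z (mem_ball_self hr)).trans_lt (half_lt_self hε)
  choose! g hg using hpt
  refine ⟨g, fun z hz => ?_, hg⟩
  obtain ⟨r, hr, hrΩ, h⟩ := hc z hz
  have hsub : ball z (r / 2) ⊆ Ω := (ball_subset_ball (by linarith)).trans hrΩ
  have hder : ∀ ε > 0, ∃ N, ∀ k ≥ N, ∀ l ≥ N, ∀ w ∈ ball z (r / 2),
      ‖fderiv ℂ (f k) w - fderiv ℂ (f l) w‖ ≤ ε := by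
    intro ε hε
    obtain ⟨N, hN⟩ := h (ε * (r / 2) / 2) (by positivity)
    refine ⟨N, fun k hk l hl w hw => ?_⟩
    have hwr : ball w (r / 2) ⊆ ball z r := by
      refine ball_subset_ball' ?_
      rw [mem_ball] at hw
      linarith
    have hwΩ : Ω ∈ 𝓝 w := hΩ.mem_nhds (hsub hw)
    have hwm : w ∈ ball z r := hwr (mem_ball_self (by linarith))
    rw [← fderiv_fun_sub ((hf k).differentiableAt hwΩ) ((hf l).differentiableAt hwΩ)]
    have := Complex.norm_fderiv_le_div_of_mapsTo_ball (f := fun y => f k y - f l y) (c := w)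
      (R₁ := r / 2) (R₂ := ε * (r / 2))
      (((hf k).sub (hf l)).mono (hwr.trans hrΩ)) ?_ (by linarith)
    · rwa [mul_div_cancel_right₀ _ (by positivity)] at this
    · intro y hy
      rw [mem_closedBall, dist_eq_norm]
      refine (norm_sub_le _ _).trans ?_
      have h1 := hN k hk l hl y (hwr hy)
      have h2 := hN k hk l hl w hwm
      linarith
  have hdpt : ∀ w ∈ ball z (r / 2), ∃ L, Tendsto (fun k => fderiv ℂ (f k) w) atTop (𝓝 L) := by
    intro w hw
    refine cauchySeq_tendsto_of_complete (Metric.cauchySeq_iff.2 fun ε hε => ?_)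
    obtain ⟨N, hN⟩ := hder (ε / 2) (half_pos hε)
    refine ⟨N, fun k hk l hl => ?_⟩
    rw [dist_eq_norm]
    exact (hN k hk l hl w hw).trans_lt (half_lt_self hε)
  choose! g' hg' using hdpt
  have hunif : TendstoUniformlyOn (fun k => fderiv ℂ (f k)) g' atTop (ball z (r / 2)) := by
    refine UniformCauchySeqOn.tendstoUniformlyOn_of_tendsto
      (Metric.uniformCauchySeqOn_iff.2 fun ε hε => ?_) hg'
    obtain ⟨N, hN⟩ := hder (ε / 2) (half_pos hε)
    refine ⟨N, fun k hk l hl w hw => ?_⟩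
    rw [dist_eq_norm]
    exact (hN k hk l hl w hw).trans_lt (half_lt_self hε)
  exact (hasFDerivAt_of_tendstoUniformlyOn isOpen_ball hunif
    (fun k w hw => ((hf k).differentiableAt (hΩ.mem_nhds (hsub hw))).hasFDerivAt)
    (fun w hw => hg w (hsub hw))
    (mem_ball_self (half_pos hr))).differentiableAt.differentiableWithinAt

/-! ### The Bergman space, the Bergman projection and Toeplitz operators -/

/-- The Bergman space `A²(Ω)`: the classes in `L²(Ω)` that have a representative holomorphic on
`Ω` (holomorphic means complex differentiable at every point of the open set `Ω`). -/
def bergmanSpace {n : ℕ} (Ω : Opens (Fin n → ℂ)) :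
    Submodule ℂ (Lp ℂ 2 (volume.restrict (Ω : Set (Fin n → ℂ)))) where
  carrier := {F | ∃ g : (Fin n → ℂ) → ℂ, DifferentiableOn ℂ g (Ω : Set (Fin n → ℂ)) ∧
    F =ᵐ[volume.restrict (Ω : Set (Fin n → ℂ))] g}
  add_mem' := by
    rintro F G ⟨f, hf, hF⟩ ⟨g, hg, hG⟩
    exact ⟨f + g, hf.add hg, (Lp.coeFn_add F G).trans (hF.add hG)⟩
  zero_mem' := ⟨0, differentiableOn_const 0, Lp.coeFn_zero _ _ _⟩
  smul_mem' := by
    rintro c F ⟨f, hf, hF⟩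
    exact ⟨c • f, hf.const_smul c, (Lp.coeFn_smul c F).trans (hF.const_smul c)⟩

theorem isClosed_bergmanSpace {n : ℕ} (Ω : Opens (Fin n → ℂ)) :
    IsClosed (bergmanSpace Ω : Set (Lp ℂ 2 (volume.restrict (Ω : Set (Fin n → ℂ))))) := by
  refine IsSeqClosed.isClosed fun F F₀ hF hlim => ?_
  choose f hf hFf using hF
  have hcau := hlim.cauchySeq
  obtain ⟨g, hg, hpt⟩ := differentiableOn_limit Ω.isOpen hf (fun z hz => by
    obtain ⟨r, hr, hrΩ⟩ := Metric.isOpen_iff.1 Ω.isOpen z hz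
    obtain ⟨C, hC, hb⟩ := exists_bound n (half_pos hr)
    refine ⟨r / 2, half_pos hr, (ball_subset_ball (by linarith)).trans hrΩ, fun ε hε => ?_⟩
    obtain ⟨N, hN⟩ := Metric.cauchySeq_iff.1 hcau (ε / C) (by positivity)
    refine ⟨N, fun k hk l hl w hw => ?_⟩
    have h1 := hb Ω Ω.isOpen (f k - f l) ((hf k).sub (hf l)) (F k - F l)
      ((Lp.coeFn_sub _ _).trans ((hFf k).sub (hFf l))) w
      ((ball_subset_ball' (by rw [mem_ball] at hw; linarith)).trans hrΩ)
    have h2 := hN k hk l hl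
    rw [dist_eq_norm, lt_div_iff₀ hC] at h2
    refine h1.trans ?_
    rw [mul_comm]
    exact h2.le)
  refine ⟨g, hg, ?_⟩
  obtain ⟨ns, hns, hae⟩ := (tendstoInMeasure_of_tendsto_Lp hlim).exists_seq_tendsto_ae
  have hall : ∀ᵐ x ∂(volume.restrict (Ω : Set (Fin n → ℂ))), ∀ k, F k x = f k x :=
    ae_all_iff.2 hFf
  filter_upwards [hae, hall, ae_restrict_mem Ω.isOpen.measurableSet] with x hx hx' hxΩ
  refine tendsto_nhds_unique hx ?_
  simp only [hx']
  exact (hpt x hxΩ).comp hns.tendsto_atTop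

instance instHasOrthogonalProjection {n : ℕ} (Ω : Opens (Fin n → ℂ)) :
    (bergmanSpace Ω).HasOrthogonalProjection :=
  haveI : CompleteSpace (bergmanSpace Ω) := (isClosed_bergmanSpace Ω).completeSpace_coe
  inferInstance

/-- The Bergman projection `P : L²(Ω) → A²(Ω)`, the orthogonal projection. -/
noncomputable def bergmanProjection {n : ℕ} (Ω : Opens (Fin n → ℂ)) :
    Lp ℂ 2 (volume.restrict (Ω : Set (Fin n → ℂ))) →L[ℂ] bergmanSpace Ω :=
  (bergmanSpace Ω).orthogonalProjectionOnto

/-- Multiplication `F ↦ φ F` on `L²(Ω)` by `φ ∈ L^∞(Ω)`. -/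
noncomputable def mulOperator {n : ℕ} (Ω : Opens (Fin n → ℂ))
    (φ : Lp ℂ ∞ (volume.restrict (Ω : Set (Fin n → ℂ)))) :
    Lp ℂ 2 (volume.restrict (Ω : Set (Fin n → ℂ))) →L[ℂ]
      Lp ℂ 2 (volume.restrict (Ω : Set (Fin n → ℂ))) :=
  (ContinuousLinearMap.mul ℂ ℂ).holderL (volume.restrict (Ω : Set (Fin n → ℂ))) ∞ 2 2 φ

/-- The Toeplitz operator `T_φ F = P (φ F)` on `A²(Ω)` with symbol `φ ∈ L^∞(Ω)`. -/
noncomputable def toeplitz {n : ℕ} (Ω : Opens (Fin n → ℂ))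
    (φ : Lp ℂ ∞ (volume.restrict (Ω : Set (Fin n → ℂ)))) :
    bergmanSpace Ω →L[ℂ] bergmanSpace Ω :=
  (bergmanProjection Ω).comp ((mulOperator Ω φ).comp (bergmanSpace Ω).subtypeL)

/-- `Ω` is Reinhardt: invariant under independent rotations of the coordinates. -/
def IsReinhardt {n : ℕ} (Ω : Set (Fin n → ℂ)) : Prop :=
  ∀ z ∈ Ω, ∀ θ : Fin n → ℝ, (fun j => Complex.exp (θ j * Complex.I) * z j) ∈ Ω

/-- `φ` is (separately) quasi-homogeneous on `Ω`: in polar coordinates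
`φ(r₁e^{iθ₁}, …, rₙe^{iθₙ}) = f(r₁, …, rₙ) e^{i(k₁θ₁ + ⋯ + kₙθₙ)}` for some `k ∈ ℤⁿ`.
Only the values of `f` on `[0,∞)ⁿ` matter. -/
def IsQuasiHomogeneousOn {n : ℕ} (Ω : Set (Fin n → ℂ)) (φ : (Fin n → ℂ) → ℂ) : Prop :=
  ∃ (f : (Fin n → ℝ) → ℂ) (k : Fin n → ℤ), ∀ r θ : Fin n → ℝ, (∀ j, 0 ≤ r j) →
    (fun j => (r j : ℂ) * Complex.exp (θ j * Complex.I)) ∈ Ω →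
    φ (fun j => (r j : ℂ) * Complex.exp (θ j * Complex.I)) =
      f r * Complex.exp (Complex.I * ∑ j, (k j : ℂ) * (θ j : ℂ))

end Bergman

/-! Let `φ j` have weight `k j`. Rotations preserve A²(Ω) and are unitary on L²(Ω), so they commute
with P, and a holomorphic function of weight β ∈ ℕⁿ on Ω is a multiple of z^β. Hence the Toeplitz
operator of `φ j` sends z^α to c z^(α + k j) whenever α + k j ∈ ℕⁿ, and c = 0 forces ∫ φ_j z^α
conj(z^(α + k j)) = 0 (`exists_toeplitz_monA2`). Choose multi-indices a_j ∈ ℕⁿ with a_(j+1) = a_j +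
k_j. Applying the operator product to z^(a_0 + β) shows that, for every β, one of the moments M_j(β)
= ∫ g_j |z^β|² vanishes, where g_j = φ_j z^(a_j) conj(z^(a_(j+1))) is rotation invariant.

The difficulty is that the index j depends on β. To make it uniform, put x_i = |z_i|²/R² ∈ [0,1] and
let the exponent be complex: M_j(s) = ∫ g_j x^s, which up to a nonzero factor is the old moment at s
= β. Since x^s is multiplicative in x, Fubini makes ∏ M_j(s) a single moment ∫ y^s of a complex
measure on the cube, the multiplicative convolution of the individual ones. It annihilates all
monomials, hence all continuous functions by Stone–Weierstrass, in particular y^s for Re s > 0. So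
the holomorphic functions M_j have product zero on a connected open set, and one of them vanishes
identically (`exists_integral_eq_zero_of_prod`).

For that j the moments of g_j with positive exponents vanish, and the mixed moments vanish by
rotation invariance. A second use of Stone–Weierstrass gives g_j = 0 a.e.
(`ae_eq_zero_of_radial_moments`), so φ_j = 0 a.e., because monomials are nonzero off the coordinate
hyperplanes. -/

namespace Bergman

/-! ### Holomorphic functions of several variables -/

/-- Identity theorem for holomorphic functions on an open connected subset of a complex normed
space. -/
theorem eqOn_zero_of_eventuallyEq_zero {E : Type*} [NormedAddCommGroup E] [NormedSpace ℂ E]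
    {U : Set E} (hU : IsOpen U) (hc : IsPreconnected U) {f : E → ℂ}
    (hf : DifferentiableOn ℂ f U) {z : E} (hz : z ∈ U) (h : f =ᶠ[𝓝 z] 0) : EqOn f 0 U := by
  have key : U ⊆ {x | f =ᶠ[𝓝 x] 0} := by
    refine hc.subset_of_closure_inter_subset isOpen_setOfPred_eventually_nhds ⟨z, hz, h⟩ ?_
    rintro p ⟨hp, hpU⟩
    obtain ⟨r, hr, hrU⟩ := Metric.isOpen_iff.1 hU p hpU
    obtain ⟨p', hp', hp'r⟩ := Metric.mem_closure_iff.1 hp r hr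
    rw [dist_comm] at hp'r
    filter_upwards [ball_mem_nhds p hr] with w hw
    -- Restrict to the complex line from a nearby zero germ `p'` to `w`. It meets the ball in a
    -- convex set, so the one-variable identity theorem carries the vanishing from t = 0 to t = 1.
    set l : ℂ → E := fun t => p' + t • (w - p') with hl
    have hlc : Continuous l := by fun_prop
    have hS : IsOpen (l ⁻¹' ball p r) := isOpen_ball.preimage hlc
    have hconv : Convex ℝ (l ⁻¹' ball p r) := by
      intro t ht s hs a b ha hb hab
      have := convex_ball p r ht hs ha hb hab
      have e : l (a • t + b • s) = a • l t + b • l s := by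
        simp only [hl]
        have e1 : p' = a • p' + b • p' := by rw [← add_smul, hab, one_smul]
        rw [add_smul, smul_assoc, smul_assoc, smul_add, smul_add]
        nth_rewrite 1 [e1]
        abel
      rw [mem_preimage, e]
      exact this
    have h0 : (0 : ℂ) ∈ l ⁻¹' ball p r := by simpa [hl] using hp'r
    have h1 : (1 : ℂ) ∈ l ⁻¹' ball p r := by simpa [hl] using hw
    have hd : DifferentiableOn ℂ (fun t => f (l t)) (l ⁻¹' ball p r) :=
      (hf.mono hrU).comp (by fun_prop) (fun t ht => ht)
    have hev : (fun t => f (l t)) =ᶠ[𝓝 0] 0 := by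
      have h00 : l 0 = p' := by simp [hl]
      have : Tendsto l (𝓝 0) (𝓝 p') := h00 ▸ hlc.tendsto 0
      exact this.eventually hp'
    have := (hd.analyticOnNhd hS).eqOn_zero_of_preconnected_of_eventuallyEq_zero
      hconv.isPreconnected h0 hev h1
    simpa [hl] using this
  exact fun x hx => (key hx).self_of_nhds

/-- If a product of two holomorphic functions vanishes on a domain, one of the factors does. -/
theorem eqOn_zero_or_eqOn_zero_of_mul {E : Type*} [NormedAddCommGroup E] [NormedSpace ℂ E]
    {U : Set E} (hU : IsOpen U) (hc : IsPreconnected U) {f g : E → ℂ}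
    (hf : DifferentiableOn ℂ f U) (hg : DifferentiableOn ℂ g U)
    (h : ∀ x ∈ U, f x * g x = 0) : EqOn f 0 U ∨ EqOn g 0 U := by
  by_contra! hcon
  obtain ⟨hf0, hg0⟩ := hcon
  simp only [EqOn, not_forall] at hf0
  obtain ⟨x, hx, hfx⟩ := hf0
  refine hg0 (eqOn_zero_of_eventuallyEq_zero hU hc hg hx ?_)
  have hcont : ContinuousAt f x := hf.continuousOn.continuousAt (hU.mem_nhds hx)
  filter_upwards [hcont.eventually_ne hfx, hU.mem_nhds hx] with y hy hyU
  exact (mul_eq_zero.1 (h y hyU)).resolve_left hy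

/-- If a finite product of holomorphic functions vanishes on a domain, one of the factors does. -/
theorem exists_eqOn_zero_of_prod {E ι : Type*} [NormedAddCommGroup E] [NormedSpace ℂ E]
    {U : Set E} (hU : IsOpen U) (hc : IsConnected U) {f : ι → E → ℂ} (s : Finset ι)
    (hf : ∀ i, DifferentiableOn ℂ (f i) U) (h : ∀ x ∈ U, ∏ i ∈ s, f i x = 0) :
    ∃ i ∈ s, EqOn (f i) 0 U := by
  classical
  induction s using Finset.induction_on with
  | empty =>
    obtain ⟨x, hx⟩ := hc.nonempty
    simpa using h x hx
  | insert a s ha ih =>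
    have hprod : DifferentiableOn ℂ (fun x => ∏ i ∈ s, f i x) U := fun x hx => by
      have := HasFDerivWithinAt.finsetProd (u := s) fun i _ => (hf i x hx).hasFDerivWithinAt
      exact this.differentiableWithinAt
    rcases eqOn_zero_or_eqOn_zero_of_mul hU hc.isPreconnected (hf a) hprod
      (fun x hx => by simpa only [Finset.prod_insert ha] using h x hx) with h1 | h1
    · exact ⟨a, Finset.mem_insert_self _ _, h1⟩
    · obtain ⟨i, hi, hi0⟩ := ih fun x hx => h1 hx
      exact ⟨i, Finset.mem_insert_of_mem hi, hi0⟩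

/-! ### Rotations and monomials -/

/-- Independent rotation of the coordinates by the angles `θ`. -/
noncomputable def rot {n : ℕ} (θ : Fin n → ℝ) (z : Fin n → ℂ) : Fin n → ℂ :=
  fun j => Complex.exp (θ j * Complex.I) * z j

/-- The monomial `z ↦ z^α`. -/
def mon {n : ℕ} (α : Fin n → ℕ) (z : Fin n → ℂ) : ℂ := ∏ i, z i ^ α i

/-- The character `e^{i k·θ}` of the torus. -/
noncomputable def torusChar {n : ℕ} (k : Fin n → ℤ) (θ : Fin n → ℝ) : ℂ :=
  Complex.exp (Complex.I * ∑ j, (k j : ℂ) * (θ j : ℂ))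

theorem torusChar_add {n : ℕ} (k l : Fin n → ℤ) (θ : Fin n → ℝ) :
    torusChar (k + l) θ = torusChar k θ * torusChar l θ := by
  simp only [torusChar]
  rw [← Complex.exp_add, ← mul_add, ← Finset.sum_add_distrib]
  congr 2
  refine Finset.sum_congr rfl fun j _ => ?_
  simp [add_mul]

theorem torusChar_zero {n : ℕ} (θ : Fin n → ℝ) : torusChar 0 θ = 1 := by
  simp [torusChar]

theorem torusChar_neg_mul {n : ℕ} (k : Fin n → ℤ) (θ : Fin n → ℝ) :
    torusChar (-k) θ * torusChar k θ = 1 := by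
  rw [← torusChar_add, neg_add_cancel, torusChar_zero]

theorem torusChar_ne_zero {n : ℕ} (k : Fin n → ℤ) (θ : Fin n → ℝ) : torusChar k θ ≠ 0 :=
  Complex.exp_ne_zero _

theorem conj_torusChar {n : ℕ} (k : Fin n → ℤ) (θ : Fin n → ℝ) :
    (starRingEnd ℂ) (torusChar k θ) = torusChar (-k) θ := by
  simp only [torusChar]
  rw [← Complex.exp_conj]
  congr 1
  simp [map_sum]

theorem exists_torusChar_ne_one {n : ℕ} {k : Fin n → ℤ} (hk : k ≠ 0) :
    ∃ θ, torusChar k θ ≠ 1 := by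
  obtain ⟨i, hi⟩ := Function.ne_iff.1 hk
  -- Turning only coordinate `i` by π / k_i makes the character e^{iπ} = -1.
  refine ⟨Pi.single i (Real.pi / k i), ?_⟩
  have hi' : (k i : ℂ) ≠ 0 := by exact_mod_cast hi
  have : ∑ j, (k j : ℂ) * ((Pi.single i (Real.pi / k i) : Fin n → ℝ) j : ℂ) = Real.pi := by
    rw [Finset.sum_eq_single i]
    · simp only [Pi.single_eq_same]
      push_cast
      field_simp
    · intro j _ hj
      simp [Pi.single_eq_of_ne hj]
    · simp
  rw [torusChar, this, mul_comm, Complex.exp_pi_mul_I]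
  norm_num

theorem mon_rot {n : ℕ} (α : Fin n → ℕ) (θ : Fin n → ℝ) (z : Fin n → ℂ) :
    mon α (rot θ z) = torusChar (fun i => (α i : ℤ)) θ * mon α z := by
  simp only [mon, rot, torusChar, mul_pow, Finset.prod_mul_distrib]
  congr 1
  rw [Finset.mul_sum, Complex.exp_sum]
  refine Finset.prod_congr rfl fun i _ => ?_
  rw [← Complex.exp_nat_mul]
  congr 1
  push_cast
  ring

theorem differentiable_mon {n : ℕ} (α : Fin n → ℕ) : Differentiable ℂ (mon α) := by
  unfold mon
  fun_prop

theorem continuous_mon {n : ℕ} (α : Fin n → ℕ) : Continuous (mon α) :=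
  (differentiable_mon α).continuous

theorem mon_ne_zero {n : ℕ} {α : Fin n → ℕ} {z : Fin n → ℂ} (hz : ∀ i, z i ≠ 0) : mon α z ≠ 0 :=
  Finset.prod_ne_zero_iff.2 fun i _ => pow_ne_zero _ (hz i)

theorem mon_add {n : ℕ} (α β : Fin n → ℕ) (z : Fin n → ℂ) :
    mon (α + β) z = mon α z * mon β z := by
  simp [mon, pow_add, Finset.prod_mul_distrib]

theorem hasDerivAt_rot_single {n : ℕ} (z : Fin n → ℂ) (j : Fin n) :
    HasDerivAt (fun t : ℝ => rot (Pi.single j t) z) (Pi.single j (Complex.I * z j)) 0 := by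
  rw [hasDerivAt_pi]
  intro i
  by_cases hij : i = j
  · subst hij
    simp only [rot, Pi.single_eq_same]
    have h1 : HasDerivAt (fun t : ℝ => (t : ℂ) * Complex.I) Complex.I 0 := by
      simpa using (Complex.ofRealCLM.hasDerivAt (x := (0 : ℝ))).mul_const Complex.I
    simpa using (h1.cexp).mul_const (z i)
  · simp only [rot, Pi.single_eq_of_ne hij]
    simpa using hasDerivAt_const (0 : ℝ) (z i)

/-- Differentiating h along the orbit of the j-th rotation at angle 0 gives i z_j ∂_j h(z) = 0, and
z_j ≠ 0. -/
theorem fderiv_eq_zero_of_rot_invariant {n : ℕ} {W : Set (Fin n → ℂ)} (hW : IsOpen W)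
    {h : (Fin n → ℂ) → ℂ} (hd : DifferentiableOn ℂ h W) {z : Fin n → ℂ} (hz : z ∈ W)
    (hz0 : ∀ i, z i ≠ 0) (hinv : ∀ θ, h (rot θ z) = h z) : fderiv ℂ h z = 0 := by
  have hz' : HasFDerivAt h (fderiv ℂ h z) z := (hd.differentiableAt (hW.mem_nhds hz)).hasFDerivAt
  refine ContinuousLinearMap.coe_inj.1 (LinearMap.pi_ext' fun j => ?_)
  ext
  have hr0 : rot (Pi.single j 0) z = z := by
    funext i
    simp [rot]
  have h1 : HasDerivAt (fun t : ℝ => h (rot (Pi.single j t) z))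
      (fderiv ℂ h z (Pi.single j (Complex.I * z j))) 0 := by
    have h2 : HasFDerivAt h ((fderiv ℂ h z).restrictScalars ℝ) (rot (Pi.single j 0) z) := by
      rw [hr0]
      exact hz'.restrictScalars ℝ
    exact h2.comp_hasDerivAt (0 : ℝ) (hasDerivAt_rot_single z j)
  simp only [hinv] at h1
  have h3 := h1.unique (hasDerivAt_const (0 : ℝ) (h z))
  have h4 : (Pi.single j (Complex.I * z j) : Fin n → ℂ)
      = (Complex.I * z j) • Pi.single j (1 : ℂ) := by
    rw [← Pi.single_smul]
    simp
  rw [h4, map_smul, smul_eq_mul] at h3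
  simpa using (mul_eq_zero.1 h3).resolve_left (mul_ne_zero Complex.I_ne_zero (hz0 j))

theorem isOpen_forall_ne_zero {n : ℕ} : IsOpen {z : Fin n → ℂ | ∀ i, z i ≠ 0} := by
  simp only [ofPred_forall]
  exact isOpen_iInter_of_finite fun i =>
    isOpen_compl_singleton.preimage (continuous_apply i)

theorem dense_forall_ne_zero {n : ℕ} : Dense {z : Fin n → ℂ | ∀ i, z i ≠ 0} := by
  have := dense_pi (ι := Fin n) (s := fun _ => ({0}ᶜ : Set ℂ)) univ
    fun i _ => dense_compl_singleton 0
  convert this using 1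
  ext z
  simp

/-- A quasi-homogeneous holomorphic function on a Reinhardt domain whose weight is a multi-index
of natural numbers is a multiple of a monomial. -/
theorem exists_eqOn_mul_mon {n : ℕ} {Ω : Set (Fin n → ℂ)} (hΩ : IsOpen Ω) (hc : IsConnected Ω)
    {g : (Fin n → ℂ) → ℂ} (hg : DifferentiableOn ℂ g Ω) (β : Fin n → ℕ)
    (hq : ∀ θ, ∀ z ∈ Ω, g (rot θ z) = torusChar (fun i => (β i : ℤ)) θ * g z) :
    ∃ c : ℂ, EqOn g (fun z => c * mon β z) Ω := by
  set W := Ω ∩ {z : Fin n → ℂ | ∀ i, z i ≠ 0} with hWdef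
  have hW : IsOpen W := hΩ.inter isOpen_forall_ne_zero
  obtain ⟨p, hpΩ, hp0⟩ : W.Nonempty := dense_forall_ne_zero.inter_open_nonempty Ω hΩ hc.nonempty
  set h : (Fin n → ℂ) → ℂ := fun z => g z / mon β z with hh
  have hd : DifferentiableOn ℂ h W := by
    simp only [hh, div_eq_mul_inv]
    exact (hg.mono inter_subset_left).mul
      ((differentiable_mon β).differentiableOn.inv fun z hz => mon_ne_zero hz.2)
  have hder : ∀ z ∈ W, fderiv ℂ h z = 0 := fun z hz =>
    fderiv_eq_zero_of_rot_invariant hW hd hz hz.2 fun θ => by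
      simp only [hh]
      rw [hq θ z hz.1, mon_rot, mul_div_mul_left _ _ (torusChar_ne_zero _ _)]
  -- The quotient g / z^β need only be constant on one ball; the identity theorem on Ω does the
  -- rest, so connectedness of `W` is never needed.
  obtain ⟨r, hr, hrW⟩ := Metric.isOpen_iff.1 hW p ⟨hpΩ, hp0⟩
  have hconst : ∀ w ∈ ball p r, h w = h p := fun w hw =>
    isOpen_ball.is_const_of_fderiv_eq_zero (convex_ball p r).isPreconnected (hd.mono hrW)
      (fun z hz => hder z (hrW hz)) hw (mem_ball_self hr)
  refine ⟨h p, fun z hz => ?_⟩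
  have := eqOn_zero_of_eventuallyEq_zero hΩ hc.isPreconnected
    (hg.sub ((differentiable_mon β).differentiableOn.const_mul (h p))) hpΩ (by
      filter_upwards [ball_mem_nhds p hr] with w hw
      have h1 := hconst w hw
      have h2 : mon β w ≠ 0 := mon_ne_zero (hrW hw).2
      simp only [hh] at h1
      rw [div_eq_iff h2] at h1
      simp [hh, h1]) hz
  exact sub_eq_zero.1 this

/-! ### Integrals against a multiplicative family of continuous functions -/

/-- An integrable density that annihilates a conjugation-invariant, point-separating multiplicative
family of continuous functions on a compact space annihilates every continuous function. -/
theorem integral_mul_comp_eq_zero {K X : Type*} [TopologicalSpace K] [CompactSpace K]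
    [MeasurableSpace K] [BorelSpace K] [MeasurableSpace X] {ν : Measure X} {G : X → ℂ}
    (hG : Integrable G ν) {Φ : X → K} (hΦ : Measurable Φ) (S : Submonoid C(K, ℂ))
    (hstar : ∀ f ∈ S, star f ∈ S) (hsep : ∀ x y : K, x ≠ y → ∃ f ∈ S, f x ≠ f y)
    (h0 : ∀ f ∈ S, ∫ ω, G ω * f (Φ ω) ∂ν = 0) (h : C(K, ℂ)) :
    ∫ ω, G ω * h (Φ ω) ∂ν = 0 := by
  have hint : ∀ f : C(K, ℂ), Integrable (fun ω => G ω * f (Φ ω)) ν := fun f =>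
    hG.mul_bdd (f.continuous.measurable.comp hΦ).aestronglyMeasurable
      (ae_of_all _ fun ω => f.norm_coe_le_norm (Φ ω))
  -- Bounded by the L¹ norm of `G`, so its kernel is closed and Stone–Weierstrass applies.
  let T : C(K, ℂ) →L[ℂ] ℂ := LinearMap.mkContinuous
    { toFun := fun f => ∫ ω, G ω * f (Φ ω) ∂ν
      map_add' := fun f g => by
        rw [← integral_add (hint f) (hint g)]
        simp [mul_add]
      map_smul' := fun c f => by
        rw [RingHom.id_apply, smul_eq_mul, ← integral_const_mul]
        refine integral_congr_ae (ae_of_all _ fun ω => ?_)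
        simp only [ContinuousMap.smul_apply, smul_eq_mul]
        ring } (∫ ω, ‖G ω‖ ∂ν) fun f => by
      rw [LinearMap.coe_mk, AddHom.coe_mk, ← integral_mul_const]
      refine norm_integral_le_of_norm_le (hG.norm.mul_const _) (ae_of_all _ fun ω => ?_)
      rw [norm_mul]
      gcongr
      exact f.norm_coe_le_norm (Φ ω)
  let A : StarSubalgebra ℂ C(K, ℂ) := StarAlgebra.adjoin ℂ (S : Set C(K, ℂ))
  have hsub : (S : Set C(K, ℂ)) ⊆ A := StarAlgebra.subset_adjoin ℂ _
  have hA : A.SeparatesPoints := by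
    intro x y hxy
    obtain ⟨f, hf, hfxy⟩ := hsep x y hxy
    exact ⟨f, ⟨f, hsub hf, rfl⟩, hfxy⟩
  have htop := ContinuousMap.starSubalgebra_topologicalClosure_eq_top_of_separatesPoints A hA
  have hunion : (S : Set C(K, ℂ)) ∪ star (S : Set C(K, ℂ)) = S :=
    union_eq_self_of_subset_right fun f hf => by simpa using hstar _ hf
  -- `S` is closed under products and conjugation, so the star algebra it generates is just its
  -- linear span.
  have hspan : ∀ f ∈ A, T f = 0 := by
    intro f hf
    have h1 : f ∈ Submodule.span ℂ (S : Set C(K, ℂ)) := by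
      have h2 : f ∈ Algebra.adjoin ℂ ((S : Set C(K, ℂ)) ∪ star (S : Set C(K, ℂ))) := hf
      rw [hunion, ← Subalgebra.mem_toSubmodule, Algebra.adjoin_eq_span,
        Submonoid.closure_eq] at h2
      exact h2
    have h3 : Submodule.span ℂ (S : Set C(K, ℂ)) ≤ LinearMap.ker T.toLinearMap :=
      Submodule.span_le.2 fun f hf => h0 f hf
    exact h3 h1
  have hh : h ∈ closure (A : Set C(K, ℂ)) := by
    rw [← StarSubalgebra.topologicalClosure_coe, htop]
    trivial
  exact closure_minimal hspan (isClosed_singleton.preimage T.continuous) hh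

/-! ### Moments with complex exponents -/

/-- The multiplicative character `y ↦ ∏ y_j ^ s_j` of the cube `[0,1]ⁿ`. -/
noncomputable def cubePow {n : ℕ} (s : Fin n → ℂ) : (Fin n → unitInterval) →* ℂ where
  toFun y := ∏ j, ((y j : ℝ) : ℂ) ^ s j
  map_one' := by simp
  map_mul' y z := by
    rw [← Finset.prod_mul_distrib]
    refine Finset.prod_congr rfl fun j _ => ?_
    rw [Pi.mul_apply, Set.Icc.coe_mul, Complex.ofReal_mul,
      Complex.mul_cpow_ofReal_nonneg (y j).2.1 (z j).2.1]

theorem cubePow_apply {n : ℕ} (s : Fin n → ℂ) (y : Fin n → unitInterval) :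
    cubePow s y = ∏ j, ((y j : ℝ) : ℂ) ^ s j := rfl

theorem cubePow_natCast {n : ℕ} (β : Fin n → ℕ) (y : Fin n → unitInterval) :
    cubePow (fun j => (β j : ℂ)) y = ∏ j, ((y j : ℝ) : ℂ) ^ β j := by
  simp [cubePow_apply]

/-- Zero exponents are allowed here: with 0^0 = 1 such a factor is constantly 1. -/
theorem continuous_cubePow_natCast {n : ℕ} (β : Fin n → ℕ) :
    Continuous fun y : Fin n → unitInterval => cubePow (fun j => (β j : ℂ)) y := by
  simp only [cubePow_natCast]
  fun_prop

/-- Positive real part is what gives continuity at the faces y_j = 0. -/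
theorem continuous_cubePow {n : ℕ} {s : Fin n → ℂ} (hs : ∀ j, 0 < (s j).re) :
    Continuous fun y : Fin n → unitInterval => cubePow s y := by
  simp only [cubePow_apply]
  refine continuous_finsetProd _ fun j _ => ?_
  exact (Complex.continuous_ofReal_cpow_const (hs j)).comp (by fun_prop)

theorem norm_cubePow_le_one {n : ℕ} {s : Fin n → ℂ} (hs : ∀ j, 0 < (s j).re)
    (y : Fin n → unitInterval) : ‖cubePow s y‖ ≤ 1 := by
  rw [cubePow_apply, norm_prod]
  refine Finset.prod_le_one (fun _ _ => norm_nonneg _) fun j _ => ?_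
  rw [Complex.norm_cpow_eq_rpow_re_of_nonneg (y j).2.1 (hs j).ne']
  exact Real.rpow_le_one (y j).2.1 (y j).2.2 (hs j).le

theorem isOpen_forall_re_pos (n : ℕ) : IsOpen {s : Fin n → ℂ | ∀ j, 0 < (s j).re} := by
  simp only [ofPred_forall]
  exact isOpen_iInter_of_finite fun j => isOpen_lt continuous_const (by fun_prop)

theorem isConnected_forall_re_pos (n : ℕ) : IsConnected {s : Fin n → ℂ | ∀ j, 0 < (s j).re} := by
  refine Convex.isConnected ?_ ⟨1, by simp⟩
  intro s hs t ht a b ha hb hab j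
  have h1 := hs j
  have h2 := ht j
  simp only [Pi.add_apply, Pi.smul_apply, Complex.add_re, Complex.real_smul, Complex.mul_re,
    Complex.ofReal_re, Complex.ofReal_im, zero_mul, sub_zero]
  rcases ha.eq_or_lt with rfl | ha
  · have : b = 1 := by linarith
    simp [this, h2]
  · have := mul_pos ha h1
    have := mul_nonneg hb h2.le
    linarith

/-- The derivative of `s ↦ cubePow s y`. -/
noncomputable def cubePowDeriv {n : ℕ} (s : Fin n → ℂ) (y : Fin n → unitInterval) :
    (Fin n → ℂ) →L[ℂ] ℂ :=
  ∑ i, (∏ j ∈ Finset.univ.erase i, ((y j : ℝ) : ℂ) ^ s j) •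
    (((y i : ℝ) : ℂ) ^ s i * Complex.log (y i : ℝ)) •
      (ContinuousLinearMap.proj i : (Fin n → ℂ) →L[ℂ] ℂ)

theorem hasFDerivAt_cubePow {n : ℕ} {s : Fin n → ℂ} (hs : ∀ j, 0 < (s j).re)
    (y : Fin n → unitInterval) :
    HasFDerivAt (fun s => cubePow s y) (cubePowDeriv s y) s := by
  simp only [cubePow_apply]
  refine HasFDerivAt.finsetProd fun i _ => ?_
  refine HasFDerivAt.const_cpow (hasFDerivAt_apply i s) (Or.inr ?_)
  intro h
  have := hs i
  rw [h] at this
  simp at this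

theorem measurable_cubePowDeriv {n : ℕ} (s : Fin n → ℂ) :
    Measurable fun y : Fin n → unitInterval => cubePowDeriv s y := by
  unfold cubePowDeriv
  refine Finset.measurable_sum _ fun i _ => Measurable.fun_smul ?_ (Measurable.fun_smul ?_
    measurable_const)
  · refine Finset.measurable_prod _ fun j _ => ?_
    fun_prop
  · fun_prop

/-- The moments of an integrable density on the cube depend holomorphically on the exponent. -/
theorem differentiableOn_integral_cubePow {X : Type*} [MeasurableSpace X] {μ : Measure X} {n : ℕ}
    {x : X → Fin n → unitInterval} (hx : Measurable x) {g : X → ℂ} (hg : Integrable g μ) :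
    DifferentiableOn ℂ (fun s : Fin n → ℂ => ∫ ω, g ω * cubePow s (x ω) ∂μ)
      {s | ∀ j, 0 < (s j).re} := by
  intro s₀ hs₀
  obtain ⟨r, hr, hrC⟩ := Metric.isOpen_iff.1 (isOpen_forall_re_pos n) s₀ hs₀
  have hmeas : ∀ s ∈ {s : Fin n → ℂ | ∀ j, 0 < (s j).re},
      AEStronglyMeasurable (fun ω => cubePow s (x ω)) μ := fun s hs =>
    ((continuous_cubePow hs).measurable.comp hx).aestronglyMeasurable
  -- A Cauchy estimate: |y^s| ≤ 1, so y^s varies by at most 2 on a ball of radius r/2. The bound is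
  -- uniform in `y`, despite the logarithm in the derivative.
  have hbound : ∀ s ∈ ball s₀ (r / 2), ∀ y, ‖cubePowDeriv s y‖ ≤ 2 / (r / 2) := by
    intro s hs y
    have hsr : ball s (r / 2) ⊆ ball s₀ r := by
      refine ball_subset_ball' ?_
      rw [mem_ball] at hs
      linarith
    have hsC := hrC (hsr (mem_ball_self (half_pos hr)))
    rw [← (hasFDerivAt_cubePow hsC y).fderiv]
    refine Complex.norm_fderiv_le_div_of_mapsTo_ball (f := fun s => cubePow s y) (c := s)
      (fun t ht => (hasFDerivAt_cubePow (hrC (hsr ht))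
        y).differentiableAt.differentiableWithinAt) ?_ (half_pos hr)
    intro t ht
    rw [mem_closedBall, dist_eq_norm]
    have h1 := norm_cubePow_le_one (hrC (hsr ht)) y
    have h2 := norm_cubePow_le_one hsC y
    exact (norm_sub_le _ _).trans (by linarith)
  refine (hasFDerivAt_integral_of_dominated_of_fderiv_le
    (F' := fun s ω => g ω • cubePowDeriv s (x ω)) (bound := fun ω => ‖g ω‖ * (2 / (r / 2)))
    (ball_mem_nhds s₀ (half_pos hr)) ?_ ?_ ?_ ?_ ?_
    ?_).differentiableAt.differentiableWithinAt
  · filter_upwards [(isOpen_forall_re_pos n).mem_nhds hs₀] with s hs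
    exact hg.aestronglyMeasurable.mul (hmeas s hs)
  · exact hg.mul_bdd (hmeas s₀ hs₀) (ae_of_all _ fun ω => norm_cubePow_le_one hs₀ _)
  · exact hg.aestronglyMeasurable.smul
      ((measurable_cubePowDeriv s₀).comp hx).aestronglyMeasurable
  · refine ae_of_all _ fun ω s hs => ?_
    rw [norm_smul]
    gcongr
    exact hbound s hs _
  · exact hg.norm.mul_const _
  · refine ae_of_all _ fun ω s hs => ?_
    exact (hasFDerivAt_cubePow (hrC (ball_subset_ball (by linarith) hs)) (x ω)).const_mul (g ω)

/-- The submonoid of monomials on the cube. -/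
noncomputable def cubeMonomials (n : ℕ) : Submonoid C(Fin n → unitInterval, ℂ) where
  carrier := Set.range fun β : Fin n → ℕ => ⟨_, continuous_cubePow_natCast β⟩
  one_mem' := ⟨0, by ext y; simp [cubePow_apply]⟩
  mul_mem' := by
    rintro _ _ ⟨β, rfl⟩ ⟨γ, rfl⟩
    refine ⟨β + γ, ?_⟩
    ext y
    simp [cubePow_apply, pow_add, Finset.prod_mul_distrib,
      Complex.cpow_natCast, -Nat.cast_add]

/-- If the product of finitely many moment sequences of densities on the cube vanishes, one of the
densities has vanishing moments for all positive exponents. -/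
theorem exists_integral_eq_zero_of_prod {X ι : Type*} [Fintype ι] [MeasurableSpace X]
    {μ : Measure X} [SigmaFinite μ] {n : ℕ} {x : X → Fin n → unitInterval} (hx : Measurable x)
    {g : ι → X → ℂ} (hg : ∀ i, Integrable (g i) μ)
    (h : ∀ β : Fin n → ℕ, ∏ i, ∫ ω, g i ω * ∏ j, ((x ω j : ℝ) : ℂ) ^ β j ∂μ = 0) :
    ∃ i, ∀ β : Fin n → ℕ, (∀ j, 0 < β j) →
      ∫ ω, g i ω * ∏ j, ((x ω j : ℝ) : ℂ) ^ β j ∂μ = 0 := by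
  -- Fubini and multiplicativity of y ↦ y^s merge the product of moments into one moment on X^ι,
  -- taken at the coordinatewise product of the cube points.
  have hprod : ∀ s : Fin n → ℂ, ∏ i, ∫ ω, g i ω * cubePow s (x ω) ∂μ =
      ∫ p : ι → X, (∏ i, g i (p i)) * cubePow s (∏ i, x (p i)) ∂(Measure.pi fun _ => μ) := by
    intro s
    rw [← integral_fintype_prod_eq_prod (fun i ω => g i ω * cubePow s (x ω))]
    simp only [Finset.prod_mul_distrib, map_prod]
  have hΦ : Measurable fun p : ι → X => ∏ i, x (p i) :=
    Finset.measurable_prod _ fun i _ => hx.comp (measurable_pi_apply i)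
  have hG : Integrable (fun p : ι → X => ∏ i, g i (p i)) (Measure.pi fun _ => μ) :=
    Integrable.fintype_prod hg
  have hall := integral_mul_comp_eq_zero hG hΦ (cubeMonomials n) (by
      rintro _ ⟨β, rfl⟩
      refine ⟨β, ?_⟩
      ext y
      simp [cubePow_natCast]) (by
      intro y z hyz
      obtain ⟨j, hj⟩ := Function.ne_iff.1 hyz
      refine ⟨_, ⟨Pi.single j 1, rfl⟩, ?_⟩
      have : ∀ y : Fin n → unitInterval,
          cubePow (fun i => ((Pi.single j 1 : Fin n → ℕ) i : ℂ)) y = (y j : ℝ) := by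
        intro y
        rw [cubePow_natCast, Finset.prod_eq_single j]
        · simp
        · intro i _ hi
          simp [Pi.single_eq_of_ne hi]
        · simp
      simp only [ContinuousMap.coe_mk, this]
      exact fun h => hj (Subtype.ext (Complex.ofReal_injective h))) (by
      rintro _ ⟨β, rfl⟩
      rw [ContinuousMap.coe_mk, ← hprod]
      simpa only [cubePow_natCast] using h β)
  obtain ⟨i, -, hi⟩ := exists_eqOn_zero_of_prod (isOpen_forall_re_pos n)
    (isConnected_forall_re_pos n) (f := fun i s => ∫ ω, g i ω * cubePow s (x ω) ∂μ)
    Finset.univ (fun i => differentiableOn_integral_cubePow hx (hg i)) (fun s hs => by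
      rw [hprod]
      exact hall ⟨_, continuous_cubePow hs⟩)
  -- Holomorphy is known only for Re s_j > 0, so exponents with a zero entry are lost here.
  refine ⟨i, fun β hβ => ?_⟩
  have := hi (x := fun j => (β j : ℂ)) (fun j => by simpa using hβ j)
  simpa only [cubePow_natCast, Pi.zero_apply] using this

/-! ### Rotation invariance of integrals over Reinhardt domains -/

theorem rot_neg_rot {n : ℕ} (θ : Fin n → ℝ) (z : Fin n → ℂ) : rot (-θ) (rot θ z) = z := by
  funext j
  simp only [rot, Pi.neg_apply, Complex.ofReal_neg, neg_mul]
  rw [← mul_assoc, ← Complex.exp_add, neg_add_cancel, Complex.exp_zero, one_mul]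

theorem differentiable_rot {n : ℕ} (θ : Fin n → ℝ) : Differentiable ℂ (rot θ) := by
  unfold rot
  fun_prop

theorem measurePreserving_rot {n : ℕ} (θ : Fin n → ℝ) : MeasurePreserving (rot θ) := by
  have h := volume_preserving_pi (fun j : Fin n =>
    (rotation (Circle.exp (θ j))).measurePreserving)
  have e : rot θ = fun (a : Fin n → ℂ) i => rotation (Circle.exp (θ i)) (a i) := by
    funext w i
    simp [rot, rotation_apply, Circle.coe_exp]
  rw [e]
  exact h

theorem measurableEmbedding_rot {n : ℕ} (θ : Fin n → ℝ) :
    MeasurableEmbedding (rot θ : (Fin n → ℂ) → Fin n → ℂ) :=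
  (differentiable_rot θ).continuous.measurableEmbedding
    (Function.LeftInverse.injective (g := rot (-θ)) (rot_neg_rot θ))

theorem IsReinhardt.rot_mem {n : ℕ} {Ω : Set (Fin n → ℂ)} (hR : IsReinhardt Ω) (θ : Fin n → ℝ)
    {z : Fin n → ℂ} (hz : z ∈ Ω) : rot θ z ∈ Ω :=
  hR z hz θ

theorem IsReinhardt.preimage_rot {n : ℕ} {Ω : Set (Fin n → ℂ)} (hR : IsReinhardt Ω)
    (θ : Fin n → ℝ) : rot θ ⁻¹' Ω = Ω := by
  ext z
  refine ⟨fun h => ?_, fun h => hR.rot_mem θ h⟩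
  simpa [rot_neg_rot] using hR.rot_mem (-θ) h

theorem IsReinhardt.measurePreserving_rot {n : ℕ} {Ω : Set (Fin n → ℂ)} (hR : IsReinhardt Ω)
    (θ : Fin n → ℝ) : MeasurePreserving (rot θ) (volume.restrict Ω) (volume.restrict Ω) := by
  have := (Bergman.measurePreserving_rot θ).restrict_preimage_emb (measurableEmbedding_rot θ) Ω
  rwa [hR.preimage_rot θ] at this

/-- The integral of a quasi-homogeneous function of non-zero weight vanishes. -/
theorem IsReinhardt.integral_eq_zero {n : ℕ} {Ω : Set (Fin n → ℂ)} (hR : IsReinhardt Ω)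
    (hΩ : MeasurableSet Ω) {f : (Fin n → ℂ) → ℂ} {k : Fin n → ℤ} (hk : k ≠ 0)
    (hf : ∀ θ, ∀ z ∈ Ω, f (rot θ z) = torusChar k θ * f z) : ∫ z in Ω, f z = 0 := by
  obtain ⟨θ, hθ⟩ := exists_torusChar_ne_one hk
  have h1 := (hR.measurePreserving_rot θ).integral_comp (measurableEmbedding_rot θ) f
  rw [setIntegral_congr_fun hΩ (hf θ), integral_const_mul] at h1
  have h2 : (torusChar k θ - 1) * ∫ z in Ω, f z = 0 := by
    rw [sub_mul, h1, one_mul, sub_self]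
  exact (mul_eq_zero.1 h2).resolve_left (sub_ne_zero.2 hθ)

/-! ### Densities with vanishing moments -/

theorem exists_norm_le_of_isBounded {n : ℕ} {Ω : Set (Fin n → ℂ)} (hb : Bornology.IsBounded Ω)
    {f : (Fin n → ℂ) → ℂ} (hf : Continuous f) : ∃ C, ∀ z ∈ Ω, ‖f z‖ ≤ C := by
  obtain ⟨C, hC⟩ := hb.isCompact_closure.exists_bound_of_continuousOn hf.continuousOn
  exact ⟨C, fun z hz => hC z (subset_closure hz)⟩

theorem integrableOn_mul_continuous {n : ℕ} {Ω : Set (Fin n → ℂ)}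
    (hΩ : MeasurableSet Ω) (hb : Bornology.IsBounded Ω) {g f : (Fin n → ℂ) → ℂ}
    (hg : IntegrableOn g Ω) (hf : Continuous f) : IntegrableOn (fun z => g z * f z) Ω := by
  obtain ⟨C, hC⟩ := exists_norm_le_of_isBounded hb hf
  exact Integrable.mul_bdd hg hf.aestronglyMeasurable
    ((ae_restrict_mem hΩ).mono fun z hz => hC z hz)

/-- The product `z^α * conj z^β`. -/
noncomputable def biMon {n : ℕ} (α β : Fin n → ℕ) (z : Fin n → ℂ) : ℂ :=
  mon α z * (starRingEnd ℂ) (mon β z)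

theorem continuous_biMon {n : ℕ} (α β : Fin n → ℕ) : Continuous (biMon α β) :=
  (continuous_mon α).mul (Complex.continuous_conj.comp (continuous_mon β))

theorem biMon_add {n : ℕ} (α β γ δ : Fin n → ℕ) (z : Fin n → ℂ) :
    biMon (α + γ) (β + δ) z = biMon α β z * biMon γ δ z := by
  simp only [biMon, mon_add, map_mul]
  ring

theorem biMon_rot {n : ℕ} (α β : Fin n → ℕ) (θ : Fin n → ℝ) (z : Fin n → ℂ) :
    biMon α β (rot θ z) = torusChar (fun i => (α i : ℤ) - β i) θ * biMon α β z := by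
  have : (fun i => (α i : ℤ) - β i) = (fun i => (α i : ℤ)) + -fun i => (β i : ℤ) := by
    funext i
    simp [sub_eq_add_neg]
  rw [this, torusChar_add, ← conj_torusChar, biMon, mon_rot, mon_rot, map_mul, biMon]
  ring

theorem biMon_self {n : ℕ} (α : Fin n → ℕ) (z : Fin n → ℂ) :
    biMon α α z = ∏ i, ((‖z i‖ ^ 2 : ℝ) : ℂ) ^ α i := by
  simp only [biMon, mon, map_prod, map_pow, ← Finset.prod_mul_distrib]
  refine Finset.prod_congr rfl fun i _ => ?_
  rw [← mul_pow, Complex.mul_conj, Complex.normSq_eq_norm_sq]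

/-- The submonoid generated by the coordinates and their conjugates. -/
noncomputable def biMonomials {n : ℕ} (K : Set (Fin n → ℂ)) : Submonoid C(K, ℂ) where
  carrier := Set.range fun p : (Fin n → ℕ) × (Fin n → ℕ) =>
    ⟨fun z : K => biMon p.1 p.2 z, (continuous_biMon p.1 p.2).comp continuous_subtype_val⟩
  one_mem' := ⟨0, by ext z; simp [biMon, mon]⟩
  mul_mem' := by
    rintro _ _ ⟨p, rfl⟩ ⟨q, rfl⟩
    refine ⟨p + q, ?_⟩
    ext z
    exact biMon_add _ _ _ _ _

/-- An integrable function on a bounded open set all of whose moments vanish is zero. -/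
theorem ae_eq_zero_of_integral_biMon {n : ℕ} {Ω : Set (Fin n → ℂ)} (hΩ : IsOpen Ω)
    (hb : Bornology.IsBounded Ω) {g : (Fin n → ℂ) → ℂ} (hg : IntegrableOn g Ω)
    (h : ∀ α β, ∫ z in Ω, g z * biMon α β z = 0) : g =ᵐ[volume.restrict Ω] 0 := by
  obtain ⟨R, hR0, hR⟩ := hb.subset_closedBall_lt 0 (0 : Fin n → ℂ)
  set K := closedBall (0 : Fin n → ℂ) R with hK
  have : CompactSpace K := isCompact_iff_compactSpace.1 (isCompact_closedBall _ _)
  have hKm : MeasurableSet K := isClosed_closedBall.measurableSet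
  -- A measurable retraction onto `K`; its values off `K` do not matter since Ω ⊆ K.
  obtain ⟨Φ, hΦm, hΦ⟩ := (MeasurableEmbedding.subtype_coe hKm).exists_measurable_extend
    (g := (id : K → K)) measurable_id fun _ => ⟨⟨0, mem_closedBall_self hR0.le⟩⟩
  have hΦK : ∀ z ∈ Ω, (Φ z : Fin n → ℂ) = z := fun z hz =>
    congrArg Subtype.val (congrFun hΦ ⟨z, hR hz⟩)
  have key := integral_mul_comp_eq_zero hg hΦm (biMonomials K) (by
      rintro _ ⟨p, rfl⟩
      refine ⟨p.swap, ?_⟩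
      ext z
      simp [biMon, mul_comm]) (by
      intro y z hyz
      obtain ⟨j, hj⟩ := Function.ne_iff.1 (Subtype.coe_ne_coe.2 hyz)
      refine ⟨_, ⟨(Pi.single j 1, 0), rfl⟩, ?_⟩
      have : ∀ y : Fin n → ℂ, biMon (Pi.single j 1) 0 y = y j := by
        intro y
        rw [biMon, mon, Finset.prod_eq_single j]
        · simp [mon]
        · intro i _ hi
          simp [Pi.single_eq_of_ne hi]
        · simp
      simpa only [ContinuousMap.coe_mk, this] using hj) (by
      rintro _ ⟨p, rfl⟩
      rw [← h p.1 p.2]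
      refine setIntegral_congr_fun hΩ.measurableSet fun z hz => ?_
      simp only [ContinuousMap.coe_mk, hΦK z hz])
  have h0 := hΩ.ae_eq_zero_of_integral_contDiff_smul_eq_zero
    hg.locallyIntegrableOn fun ψ hψ _ hψs => by
      have hψc : Continuous fun z : K => (ψ z : ℂ) :=
        Complex.continuous_ofReal.comp (hψ.continuous.comp continuous_subtype_val)
      rw [← setIntegral_eq_integral_of_forall_compl_eq_zero (s := Ω), ← key ⟨_, hψc⟩]
      · refine setIntegral_congr_fun hΩ.measurableSet fun z hz => ?_
        simp only [ContinuousMap.coe_mk, hΦK z hz, Complex.real_smul, mul_comm]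
      · intro z hz
        rw [image_eq_zero_of_notMem_tsupport fun hz' => hz (hψs hz'), zero_smul]
  exact (ae_restrict_iff' hΩ.measurableSet).2 h0

theorem ae_forall_ne_zero {n : ℕ} : ∀ᵐ z : Fin n → ℂ, ∀ i, z i ≠ 0 := by
  refine ae_all_iff.2 fun i => ?_
  have := Measure.pi_hyperplane (fun _ : Fin n => (volume : Measure ℂ)) i 0
  rw [ae_iff]
  simpa [volume_pi] using this

/-- A rotation-invariant integrable function on a bounded open Reinhardt set whose radial moments
with positive exponents vanish is zero. -/
theorem ae_eq_zero_of_radial_moments {n : ℕ} {Ω : Set (Fin n → ℂ)} (hΩ : IsOpen Ω)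
    (hb : Bornology.IsBounded Ω) (hR : IsReinhardt Ω) {g : (Fin n → ℂ) → ℂ} (hg : IntegrableOn g Ω)
    (hinv : ∀ θ, ∀ z ∈ Ω, g (rot θ z) = g z)
    (h : ∀ β : Fin n → ℕ, (∀ i, 0 < β i) → ∫ z in Ω, g z * biMon β β z = 0) :
    g =ᵐ[volume.restrict Ω] 0 := by
  -- The weight ∏ |z_i|² raises every exponent by one, so only positive exponents occur; it is
  -- divided out a.e. at the end.
  have h1 := ae_eq_zero_of_integral_biMon hΩ hb
    (integrableOn_mul_continuous hΩ.measurableSet hb hg (continuous_biMon 1 1))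
    fun α β => by
      have e : ∀ z, g z * biMon 1 1 z * biMon α β z = g z * biMon (α + 1) (β + 1) z := by
        intro z
        rw [biMon_add]
        ring
      simp only [e]
      by_cases hαβ : α = β
      · subst hαβ
        exact h _ fun i => by simp
      -- For α ≠ β the integrand has nonzero weight α - β.
      · refine hR.integral_eq_zero hΩ.measurableSet (k := fun i => (α i : ℤ) - β i) ?_ ?_
        · intro h0
          refine hαβ (funext fun i => ?_)
          have := congrFun h0 i
          simpa [sub_eq_zero] using this
        · intro θ z hz
          rw [hinv θ z hz, biMon_rot]
          simp only [Pi.add_apply, Pi.one_apply, Nat.cast_add, Nat.cast_one,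
            add_sub_add_right_eq_sub]
          ring
  filter_upwards [h1, ae_restrict_of_ae ae_forall_ne_zero] with z hz hz0
  refine (mul_eq_zero.1 hz).resolve_right ?_
  exact mul_ne_zero (mon_ne_zero hz0) ((map_ne_zero _).2 (mon_ne_zero hz0))

/-! ### Rotations act on `L²` and commute with the Bergman projection -/

variable {n : ℕ} {Ω : Opens (Fin n → ℂ)}

/-- Composition with a rotation, as an isometry of `L²(Ω)`. -/
noncomputable def rotL2 (hR : IsReinhardt (Ω : Set (Fin n → ℂ))) (θ : Fin n → ℝ) :
    Lp ℂ 2 (volume.restrict (Ω : Set (Fin n → ℂ))) →ₗᵢ[ℂ]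
      Lp ℂ 2 (volume.restrict (Ω : Set (Fin n → ℂ))) :=
  Lp.compMeasurePreservingₗᵢ ℂ (rot θ) (hR.measurePreserving_rot θ)

theorem coeFn_rotL2 (hR : IsReinhardt (Ω : Set (Fin n → ℂ))) (θ : Fin n → ℝ)
    (F : Lp ℂ 2 (volume.restrict (Ω : Set (Fin n → ℂ)))) :
    rotL2 hR θ F =ᵐ[volume.restrict (Ω : Set (Fin n → ℂ))] fun z => F (rot θ z) :=
  Lp.coeFn_compMeasurePreserving F (hR.measurePreserving_rot θ)

theorem coeFn_rotL2_of_ae (hR : IsReinhardt (Ω : Set (Fin n → ℂ))) (θ : Fin n → ℝ)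
    {F : Lp ℂ 2 (volume.restrict (Ω : Set (Fin n → ℂ)))} {f : (Fin n → ℂ) → ℂ}
    (hF : F =ᵐ[volume.restrict (Ω : Set (Fin n → ℂ))] f) :
    rotL2 hR θ F =ᵐ[volume.restrict (Ω : Set (Fin n → ℂ))] fun z => f (rot θ z) :=
  (coeFn_rotL2 hR θ F).trans
    ((hR.measurePreserving_rot θ).quasiMeasurePreserving.ae_eq_comp hF)

theorem rotL2_mem (hR : IsReinhardt (Ω : Set (Fin n → ℂ))) (θ : Fin n → ℝ)
    {F : Lp ℂ 2 (volume.restrict (Ω : Set (Fin n → ℂ)))} (hF : F ∈ bergmanSpace Ω) :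
    rotL2 hR θ F ∈ bergmanSpace Ω := by
  obtain ⟨g, hg, hFg⟩ := hF
  exact ⟨fun z => g (rot θ z),
    hg.comp (differentiable_rot θ).differentiableOn fun z hz => hR.rot_mem θ hz,
    coeFn_rotL2_of_ae hR θ hFg⟩

theorem rotL2_rotL2_neg (hR : IsReinhardt (Ω : Set (Fin n → ℂ))) (θ : Fin n → ℝ)
    (F : Lp ℂ 2 (volume.restrict (Ω : Set (Fin n → ℂ)))) :
    rotL2 hR θ (rotL2 hR (-θ) F) = F := by
  refine Lp.ext ?_
  filter_upwards [coeFn_rotL2_of_ae hR θ (coeFn_rotL2 hR (-θ) F)] with z hz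
  rw [hz, rot_neg_rot]

/-- The rotation is an isometry, and it and its inverse preserve A²(Ω), so it also preserves the
orthogonal complement. -/
theorem starProjection_rotL2 (hR : IsReinhardt (Ω : Set (Fin n → ℂ))) (θ : Fin n → ℝ)
    (F : Lp ℂ 2 (volume.restrict (Ω : Set (Fin n → ℂ)))) :
    (bergmanSpace Ω).starProjection (rotL2 hR θ F) =
      rotL2 hR θ ((bergmanSpace Ω).starProjection F) := by
  refine Submodule.eq_starProjection_of_mem_of_inner_eq_zero
    (rotL2_mem hR θ (Submodule.starProjection_apply_mem _ _)) fun w hw => ?_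
  rw [← rotL2_rotL2_neg hR θ w, ← map_sub, LinearIsometry.inner_map_map]
  exact Submodule.starProjection_inner_eq_zero _ _ (rotL2_mem hR (-θ) hw)

/-! ### Monomials in the Bergman space -/

theorem memLp_mon (hb : Bornology.IsBounded (Ω : Set (Fin n → ℂ))) (β : Fin n → ℕ) :
    MemLp (mon β) 2 (volume.restrict (Ω : Set (Fin n → ℂ))) := by
  obtain ⟨C, hC⟩ := exists_norm_le_of_isBounded hb (continuous_mon β)
  have : IsFiniteMeasure (volume.restrict (Ω : Set (Fin n → ℂ))) :=
    isFiniteMeasure_restrict.2 hb.measure_lt_top.ne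
  exact MemLp.of_bound (continuous_mon β).aestronglyMeasurable C
    ((ae_restrict_mem Ω.isOpen.measurableSet).mono fun z hz => hC z hz)

/-- The monomial `z^β` as an element of the Bergman space of a bounded domain. -/
noncomputable def monA2 (hb : Bornology.IsBounded (Ω : Set (Fin n → ℂ))) (β : Fin n → ℕ) :
    bergmanSpace Ω :=
  ⟨(memLp_mon hb β).toLp, mon β, (differentiable_mon β).differentiableOn,
    (memLp_mon hb β).coeFn_toLp⟩

theorem coeFn_monA2 (hb : Bornology.IsBounded (Ω : Set (Fin n → ℂ))) (β : Fin n → ℕ) :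
    (monA2 hb β : Lp ℂ 2 (volume.restrict (Ω : Set (Fin n → ℂ))))
      =ᵐ[volume.restrict (Ω : Set (Fin n → ℂ))] mon β :=
  (memLp_mon hb β).coeFn_toLp

theorem monA2_ne_zero (hne : (Ω : Set (Fin n → ℂ)).Nonempty)
    (hb : Bornology.IsBounded (Ω : Set (Fin n → ℂ))) (β : Fin n → ℕ) : monA2 hb β ≠ 0 := by
  intro h
  have h1 := coeFn_monA2 hb β
  rw [h] at h1
  have h2 : (0 : (Fin n → ℂ) → ℂ) =ᵐ[volume.restrict (Ω : Set (Fin n → ℂ))] mon β :=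
    (Lp.coeFn_zero ℂ 2 _).symm.trans h1
  have h3 := Measure.eqOn_open_of_ae_eq h2 Ω.isOpen continuousOn_const
    (continuous_mon β).continuousOn
  obtain ⟨z, hzΩ, hz⟩ := dense_forall_ne_zero.inter_open_nonempty _ Ω.isOpen hne
  exact mon_ne_zero hz (h3 hzΩ).symm

/-- The Bergman projection maps functions of weight `β` to multiples of `z^β`. -/
theorem exists_starProjection_eq (hconn : IsConnected (Ω : Set (Fin n → ℂ)))
    (hb : Bornology.IsBounded (Ω : Set (Fin n → ℂ))) (hR : IsReinhardt (Ω : Set (Fin n → ℂ)))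
    (β : Fin n → ℕ) {F : Lp ℂ 2 (volume.restrict (Ω : Set (Fin n → ℂ)))}
    (hF : ∀ θ, rotL2 hR θ F = torusChar (fun i => (β i : ℤ)) θ • F) :
    ∃ c : ℂ, (bergmanSpace Ω).starProjection F = c • (monA2 hb β).1 := by
  obtain ⟨g, hg, hPg⟩ : (bergmanSpace Ω).starProjection F ∈ bergmanSpace Ω :=
    Submodule.starProjection_apply_mem _ _
  obtain ⟨c, hc⟩ := exists_eqOn_mul_mon Ω.isOpen hconn hg β fun θ z hz => by
    have h1 := coeFn_rotL2_of_ae hR θ hPg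
    rw [← starProjection_rotL2, hF, map_smul] at h1
    have h2 : (fun z => g (rot θ z)) =ᵐ[volume.restrict (Ω : Set (Fin n → ℂ))]
        fun z => torusChar (fun i => (β i : ℤ)) θ * g z := by
      filter_upwards [h1, hPg, Lp.coeFn_smul (torusChar (fun i => (β i : ℤ)) θ)
        ((bergmanSpace Ω).starProjection F)] with z hz1 hz2 hz3
      rw [← hz1, hz3, Pi.smul_apply, hz2, smul_eq_mul]
    -- Both sides are continuous, so equality a.e. on the open set holds everywhere.
    exact Measure.eqOn_open_of_ae_eq h2 Ω.isOpen
      (hg.comp (differentiable_rot θ).differentiableOn fun z hz => hR.rot_mem θ hz).continuousOn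
      (hg.continuousOn.const_mul _) hz
  refine ⟨c, Lp.ext ?_⟩
  filter_upwards [hPg, coeFn_monA2 hb β, Lp.coeFn_smul c (monA2 hb β).1,
    ae_restrict_mem Ω.isOpen.measurableSet] with z h1 h2 h3 h4
  rw [h1, h3, Pi.smul_apply, h2, smul_eq_mul]
  exact hc h4

/-! ### Toeplitz operators with quasi-homogeneous symbols -/

/-- A rotation adds θ to the arguments and keeps the moduli, so the radial factor cancels. Only this
equivariance of the symbol is used afterwards. -/
theorem IsQuasiHomogeneousOn.exists_weight {Ω : Set (Fin n → ℂ)} {φ : (Fin n → ℂ) → ℂ}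
    (hφ : IsQuasiHomogeneousOn Ω φ) (hR : IsReinhardt Ω) :
    ∃ k : Fin n → ℤ, ∀ θ, ∀ z ∈ Ω, φ (rot θ z) = torusChar k θ * φ z := by
  obtain ⟨f, k, hfk⟩ := hφ
  refine ⟨k, fun θ z hz => ?_⟩
  have h1 : (fun j => ((‖z j‖ : ℝ) : ℂ) * Complex.exp ((z j).arg * Complex.I)) = z :=
    funext fun j => Complex.norm_mul_exp_arg_mul_I (z j)
  have h2 : (fun j => ((‖z j‖ : ℝ) : ℂ) *
      Complex.exp (((fun j => θ j + (z j).arg) j : ℝ) * Complex.I)) = rot θ z := by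
    funext j
    have h3 := congrFun h1 j
    rw [rot, Complex.ofReal_add, add_mul, Complex.exp_add]
    linear_combination Complex.exp (θ j * Complex.I) * h3
  have h3 := hfk (fun j => ‖z j‖) (fun j => (z j).arg) (fun j => norm_nonneg _) (by rwa [h1])
  have h4 := hfk (fun j => ‖z j‖) (fun j => θ j + (z j).arg) (fun j => norm_nonneg _)
    (by rw [h2]; exact hR.rot_mem θ hz)
  rw [h1] at h3
  rw [h2] at h4
  rw [h4, h3, torusChar]
  have : Complex.exp (Complex.I * ∑ j, (k j : ℂ) * ((θ j + (z j).arg : ℝ) : ℂ)) =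
      Complex.exp (Complex.I * ∑ j, (k j : ℂ) * (θ j : ℂ)) *
        Complex.exp (Complex.I * ∑ j, (k j : ℂ) * ((z j).arg : ℂ)) := by
    rw [← Complex.exp_add, ← mul_add, ← Finset.sum_add_distrib]
    congr 2
    refine Finset.sum_congr rfl fun j _ => ?_
    push_cast
    ring
  rw [this]
  ring

theorem coeFn_mulOperator_monA2 (hb : Bornology.IsBounded (Ω : Set (Fin n → ℂ)))
    {φ : (Fin n → ℂ) → ℂ} (hφ : MemLp φ ∞ (volume.restrict (Ω : Set (Fin n → ℂ))))
    (α : Fin n → ℕ) :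
    mulOperator Ω (hφ.toLp φ) (monA2 hb α).1 =ᵐ[volume.restrict (Ω : Set (Fin n → ℂ))]
      fun z => φ z * mon α z := by
  have h : mulOperator Ω (hφ.toLp φ) (monA2 hb α).1 =ᵐ[volume.restrict (Ω : Set (Fin n → ℂ))]
      fun z => (ContinuousLinearMap.mul ℂ ℂ) (hφ.toLp φ z) ((monA2 hb α).1 z) :=
    (ContinuousLinearMap.mul ℂ ℂ).coeFn_holder (hφ.toLp φ) (monA2 hb α).1
  filter_upwards [h, hφ.coeFn_toLp, coeFn_monA2 hb α] with z h1 h2 h3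
  rw [h1, h2, h3, ContinuousLinearMap.mul_apply']

/-- A Toeplitz operator with quasi-homogeneous symbol of weight `k` maps `z^α` to a multiple of
`z^(α+k)`, and the multiple is zero only if the corresponding moment of the symbol is. -/
theorem exists_toeplitz_monA2 (hconn : IsConnected (Ω : Set (Fin n → ℂ)))
    (hb : Bornology.IsBounded (Ω : Set (Fin n → ℂ))) (hR : IsReinhardt (Ω : Set (Fin n → ℂ)))
    {φ : (Fin n → ℂ) → ℂ} (hφ : MemLp φ ∞ (volume.restrict (Ω : Set (Fin n → ℂ))))
    {k : Fin n → ℤ} (hk : ∀ θ, ∀ z ∈ (Ω : Set (Fin n → ℂ)), φ (rot θ z) = torusChar k θ * φ z)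
    {α β : Fin n → ℕ} (hαβ : ∀ i, (β i : ℤ) = α i + k i) :
    ∃ c : ℂ, toeplitz Ω (hφ.toLp φ) (monA2 hb α) = c • monA2 hb β ∧
      (c = 0 → ∫ z in (Ω : Set (Fin n → ℂ)), φ z * biMon α β z = 0) := by
  set F := mulOperator Ω (hφ.toLp φ) (monA2 hb α).1 with hFdef
  have hF := coeFn_mulOperator_monA2 hb hφ α
  rw [← hFdef] at hF
  have hβ : (fun i => (β i : ℤ)) = k + fun i => (α i : ℤ) := by
    funext i
    rw [Pi.add_apply, hαβ, add_comm]
  obtain ⟨c, hc⟩ := exists_starProjection_eq hconn hb hR β (F := F) fun θ => by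
    refine Lp.ext ?_
    filter_upwards [coeFn_rotL2_of_ae hR θ hF, hF, Lp.coeFn_smul
      (torusChar (fun i => (β i : ℤ)) θ) F, ae_restrict_mem Ω.isOpen.measurableSet]
      with z h1 h2 h3 h4
    rw [h1, h3, Pi.smul_apply, h2, hk θ z h4, mon_rot, hβ, torusChar_add, smul_eq_mul]
    ring
  refine ⟨c, Subtype.ext hc, fun hc0 => ?_⟩
  rw [hc0, zero_smul] at hc
  -- If c = 0, then φ z^α is orthogonal to A²(Ω), in particular to z^β; that inner product is the
  -- moment.
  have h1 : inner ℂ (monA2 hb β).1 F = 0 := by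
    have h2 := Submodule.starProjection_inner_eq_zero (K := bergmanSpace Ω) F _ (monA2 hb β).2
    rw [hc, sub_zero] at h2
    exact inner_eq_zero_symm.1 h2
  rw [L2.inner_def] at h1
  rw [← h1]
  refine integral_congr_ae ?_
  filter_upwards [hF, coeFn_monA2 hb β] with z h2 h3
  rw [h2, h3, RCLike.inner_apply, biMon]
  ring

/-- Reversal makes `T 0` act first; the induction peels off the last operator, which is the leftmost
factor. -/
theorem reverse_prod_ofFn_apply {A : Type*} [AddCommGroup A] [Module ℂ A] [TopologicalSpace A]
    {m : ℕ} (T : Fin m → A →L[ℂ] A) (e : Fin (m + 1) → A) (c : Fin m → ℂ)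
    (h : ∀ j, T j (e j.castSucc) = c j • e j.succ) :
    (List.ofFn T).reverse.prod (e 0) = (∏ j, c j) • e (Fin.last m) := by
  induction m with
  | zero => simp
  | succ m ih =>
    rw [List.ofFn_succ', List.concat_eq_append, List.reverse_append, List.reverse_singleton,
      List.singleton_append, List.prod_cons, mul_apply_eq_comp]
    have := ih (fun j => T j.castSucc) (fun j => e j.castSucc) (fun j => c j.castSucc)
      fun j => by simpa using h j.castSucc
    rw [Fin.castSucc_zero] at this
    rw [this, map_smul, h (Fin.last m), smul_smul, Fin.prod_univ_castSucc, Fin.succ_last]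

/-- Integer weights can be accumulated along multi-indices of natural numbers. -/
theorem exists_multiIndex_chain {m : ℕ} (k : Fin m → Fin n → ℤ) :
    ∃ a : Fin (m + 1) → Fin n → ℕ, ∀ j i, (a j.succ i : ℤ) = a j.castSucc i + k j i := by
  -- The starting index is the sum of the absolute values of all partial sums of the weights, large
  -- enough to keep every later index nonnegative.
  have hnn : ∀ (j : Fin (m + 1)) (i : Fin n),
      0 ≤ ∑ l, |Fin.partialSum (fun j => k j i) l| + Fin.partialSum (fun j => k j i) j := by
    intro j i
    have h1 := Finset.single_le_sum (f := fun l => |Fin.partialSum (fun j => k j i) l|)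
      (fun l _ => abs_nonneg _) (Finset.mem_univ j)
    have h2 := neg_abs_le (Fin.partialSum (fun j => k j i) j)
    linarith
  refine ⟨fun j i => (∑ l, |Fin.partialSum (fun j => k j i) l| +
    Fin.partialSum (fun j => k j i) j).toNat, fun j i => ?_⟩
  rw [Int.toNat_of_nonneg (hnn _ _), Int.toNat_of_nonneg (hnn _ _), Fin.partialSum_succ, add_assoc]

/-- The squared moduli of the coordinates, scaled and clamped to the unit cube. -/
noncomputable def sqCube (R : ℝ) (z : Fin n → ℂ) (i : Fin n) : unitInterval :=
  Set.projIcc 0 1 zero_le_one (‖z i‖ ^ 2 / R ^ 2)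

theorem measurable_sqCube (R : ℝ) : Measurable (sqCube R : (Fin n → ℂ) → Fin n → unitInterval) :=
  measurable_pi_lambda _ fun i =>
    (continuous_projIcc.comp (by fun_prop : Continuous fun z : Fin n → ℂ =>
      ‖z i‖ ^ 2 / R ^ 2)).measurable

/-- On the ball of radius `R` the clamping is inactive; the power of R² is a nonzero constant that
does not affect vanishing of moments. -/
theorem biMon_self_eq_sqCube {R : ℝ} (hR : 0 < R) {z : Fin n → ℂ} (hz : ‖z‖ ≤ R)
    (β : Fin n → ℕ) :
    biMon β β z = ((R ^ 2 : ℝ) : ℂ) ^ (∑ i, β i) * ∏ i, ((sqCube R z i : ℝ) : ℂ) ^ β i := by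
  rw [biMon_self, ← Finset.prod_pow_eq_pow_sum, ← Finset.prod_mul_distrib]
  refine Finset.prod_congr rfl fun i _ => ?_
  have h1 : ‖z i‖ ^ 2 / R ^ 2 ∈ Icc (0 : ℝ) 1 := by
    refine ⟨by positivity, ?_⟩
    rw [div_le_one (by positivity)]
    gcongr
    exact (norm_le_pi_norm z i).trans hz
  rw [sqCube, projIcc_of_mem _ h1, ← mul_pow, ← Complex.ofReal_mul]
  congr 2
  field_simp

/-- If a product of moments of rotation-invariant functions vanishes for all exponents, one of the
functions is zero. -/
theorem exists_ae_eq_zero_of_prod_moments {ι : Type*} [Fintype ι]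
    (hb : Bornology.IsBounded (Ω : Set (Fin n → ℂ))) (hR : IsReinhardt (Ω : Set (Fin n → ℂ)))
    {g : ι → (Fin n → ℂ) → ℂ} (hg : ∀ j, IntegrableOn (g j) Ω)
    (hinv : ∀ j θ, ∀ z ∈ (Ω : Set (Fin n → ℂ)), g j (rot θ z) = g j z)
    (h : ∀ β, ∏ j, ∫ z in (Ω : Set (Fin n → ℂ)), g j z * biMon β β z = 0) :
    ∃ j, g j =ᵐ[volume.restrict (Ω : Set (Fin n → ℂ))] 0 := by
  obtain ⟨R, hR0, hRb⟩ := hb.subset_closedBall_lt 0 (0 : Fin n → ℂ)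
  have hR2 : ∀ β : Fin n → ℕ, ((R ^ 2 : ℝ) : ℂ) ^ (∑ i, β i) ≠ 0 := fun β =>
    pow_ne_zero _ (Complex.ofReal_ne_zero.2 (by positivity))
  have hmom : ∀ j β, ∫ z in (Ω : Set (Fin n → ℂ)), g j z * biMon β β z =
      ((R ^ 2 : ℝ) : ℂ) ^ (∑ i, β i) *
        ∫ z in (Ω : Set (Fin n → ℂ)), g j z * ∏ i, ((sqCube R z i : ℝ) : ℂ) ^ β i := by
    intro j β
    rw [← integral_const_mul]
    refine setIntegral_congr_fun Ω.isOpen.measurableSet fun z hz => ?_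
    simp only [biMon_self_eq_sqCube hR0 (mem_closedBall_zero_iff.1 (hRb hz)) β]
    ring
  obtain ⟨j, hj⟩ := exists_integral_eq_zero_of_prod (measurable_sqCube R) hg fun β => by
    obtain ⟨j, hj, hj0⟩ := Finset.prod_eq_zero_iff.1 (h β)
    rw [hmom] at hj0
    exact Finset.prod_eq_zero hj ((mul_eq_zero.1 hj0).resolve_left (hR2 β))
  refine ⟨j, ae_eq_zero_of_radial_moments Ω.isOpen hb hR (hg j) (hinv j) fun β hβ => ?_⟩
  rw [hmom, hj β hβ, mul_zero]

end Bergman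

theorem proposition3p1 {n m : ℕ} (Ω : Opens (Fin n → ℂ))
    (hconn : IsConnected (Ω : Set (Fin n → ℂ)))
    (hbdd : Bornology.IsBounded (Ω : Set (Fin n → ℂ)))
    (hR : Bergman.IsReinhardt (Ω : Set (Fin n → ℂ)))
    (φ : Fin m → (Fin n → ℂ) → ℂ)
    (hφ : ∀ j, MemLp (φ j) ∞ (volume.restrict (Ω : Set (Fin n → ℂ))))
    (hqh : ∀ j, Bergman.IsQuasiHomogeneousOn (Ω : Set (Fin n → ℂ)) (φ j))
    -- the list is `[T_{φ_m}, …, T_{φ_1}]`, and the product is composition of operators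
    (hT : (List.ofFn fun j => Bergman.toeplitz Ω ((hφ j).toLp (φ j))).reverse.prod = 0) :
    ∃ j, φ j =ᵐ[volume.restrict (Ω : Set (Fin n → ℂ))] 0 := by
  open Bergman in
  choose k hk using fun j => (hqh j).exists_weight hR
  obtain ⟨a, ha⟩ := exists_multiIndex_chain k
  have : IsFiniteMeasure (volume.restrict (Ω : Set (Fin n → ℂ))) :=
    isFiniteMeasure_restrict.2 hbdd.measure_lt_top.ne
  have hint : ∀ j, IntegrableOn (φ j) Ω := fun j => (hφ j).integrable le_top
  obtain ⟨j, hj⟩ := exists_ae_eq_zero_of_prod_moments (ι := Fin m) hbdd hR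
    -- The monomial factor has weight a_j - a_(j+1) = -k_j, which cancels that of `φ j`.
    (g := fun j z => φ j z * biMon (a j.castSucc) (a j.succ) z)
    (fun j => integrableOn_mul_continuous Ω.isOpen.measurableSet hbdd (hint j)
      (continuous_biMon _ _))
    (fun j θ z hz => by
      rw [hk j θ z hz, biMon_rot]
      have : (fun i => (a j.castSucc i : ℤ) - a j.succ i) = -k j := by
        funext i
        rw [ha, Pi.neg_apply]
        ring
      rw [this]
      linear_combination (φ j z * biMon (a j.castSucc) (a j.succ) z) * torusChar_neg_mul (k j) θ)
    (fun β => by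
      -- Shifting the whole chain by β keeps its increments, so the operator product sends z^(a_0 +
      -- β) to (∏ c_j) z^(a_m + β).
      choose c hc hc0 using fun j => exists_toeplitz_monA2 hconn hbdd hR (hφ j) (hk j)
        (α := a j.castSucc + β) (β := a j.succ + β) (fun i => by
          simp only [Pi.add_apply, Nat.cast_add, ha]
          ring)
      have h1 := reverse_prod_ofFn_apply _ (fun j => monA2 hbdd (a j + β)) c hc
      rw [hT, zero_apply] at h1
      obtain ⟨j, hj, hj0⟩ := Finset.prod_eq_zero_iff.1
        ((smul_eq_zero.1 h1.symm).resolve_right (monA2_ne_zero hconn.nonempty hbdd _))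
      refine Finset.prod_eq_zero hj ?_
      simpa only [biMon_add, mul_assoc] using hc0 j hj0)
  refine ⟨j, ?_⟩
  filter_upwards [hj, ae_restrict_of_ae ae_forall_ne_zero] with z hz hz0
  refine (mul_eq_zero.1 hz).resolve_right ?_
  exact mul_ne_zero (mon_ne_zero hz0) ((map_ne_zero _).2 (mon_ne_zero hz0))
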